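/- Let $A$ be a (not necessarily unital) $C^*$-algebra. An element of $A$ is called positive if it is of the form $h^*h$ with $h\in A$, and the state space $\mathcal S(A)$ is the set of bounded linear functionals $\varphi:A\to\mathbb C$ with $\varphi(a)\ge 0$ for every positive $a\in A$ and $\|\varphi\|=1$. Let $P:A\to A$ be a linear map (not assumed to be bounded) with $P\circ P=P$ whose image is a $C^*$-subalgebra $B$ of $A$, that is, a norm-closed linear subspace which is closed under multiplication and under the involution. Suppose that the adjoint $P^*\varphi:=\varphi\circ P$ maps $\mathcal S(A)$ into itself, i.e. $\varphi\circ P\in\mathcal S(A)$ for every $\varphi\in\mathcal S(A)$. Then $P$ is a conditional expectation of $A$ onto $B$: $P$ is an idempotent linear map with image $B$ such that 1. (positivity) $P(a)$ is positive for every positive $a\in A$; 2. (contractivity) $\|P(a)\|\le\|a\|$ for every $a\in A$; 3. ($B$-bimodularity) $P(bab')=b\,P(a)\,b'$ for all $a\in A$ and $b,b'\in B$. -/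

import Mathlib

open scoped ComplexOrder

/-- The state space of a (not necessarily unital) C*-algebra: the bounded linear functionals that
are positive and have norm one. -/
def stateSpace (A : Type*) [NonUnitalCStarAlgebra A] [PartialOrder A] [StarOrderedRing A] :
    Set (StrongDual ℂ A) :=
  {φ | (∀ a : A, 0 ≤ a → 0 ≤ φ a) ∧ ‖φ‖ = 1}

/-- A conditional expectation on a C*-algebra `A` with image `B`: a positive contractive projection
on `A` whose image is the C*-subalgebra (norm-closed star-subalgebra, not necessarily containing a
unit of `A`) `B`, and which is a `B`-bimodule map in the sense `P (b a b') = b P(a) b'`. -/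
structure IsConditionalExpectation {A : Type*} [NonUnitalCStarAlgebra A] [PartialOrder A]
    [StarOrderedRing A] (P : A →ₗ[ℂ] A) (B : NonUnitalStarSubalgebra ℂ A) : Prop where
  isClosed_subalgebra : IsClosed (B : Set A)
  idempotent : ∀ a : A, P (P a) = P a
  range_eq : Set.range P = (B : Set A)
  positive : ∀ a : A, 0 ≤ a → 0 ≤ P a
  contractive : ∀ a : A, ‖P a‖ ≤ ‖a‖
  bimodule : ∀ a : A, ∀ b ∈ B, ∀ b' ∈ B, P (b * a * b') = b * P a * b'

/-! States separate positive elements and attain their norms, so the hypothesis makes `P` positive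
and contractive on the positive cone. This is what makes the unital extension `Q` of `P` to the
unitization positive; its fixed points are again closed under products. It remains to treat a unital
positive idempotent `Q` whose range is an algebra.

Kadison's inequality `Q a ^ 2 ≤ Q (a ^ 2)`, perturbed in the direction of a fixed self-adjoint `b`,
gives the Jordan identity `Q (ab + ba) = Q a b + b Q a`. To split it into one-sided identities, take
self-adjoint `a` with `Q a = 0` and put `D b = Q (ba)`. A Jordan-type Leibniz rule shows that `D b`
commutes with self-adjoint fixed `b`, hence `D (exp (inb)) = in exp (inb) D b`. The exponentials are
unitary and `Q`, being positive, is bounded, so `n ‖D b‖` stays bounded and `D b = 0`. Contractivity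
on all of `A` then follows from bimodularity through a Schwarz inequality. -/

/-! ### States, positivity and norms -/

section States

variable {A : Type*} [NonUnitalCStarAlgebra A] [PartialOrder A] [StarOrderedRing A]

open scoped ComplexConjugate
open scoped Pointwise

/-- The hermitian part of a functional whose real part is nonnegative on the positive cone is a
positive functional. -/
theorem exists_positive_functional_of_re_nonneg (g : StrongDual ℂ A)
    (hg : ∀ c : A, 0 ≤ c → 0 ≤ (g c).re) :
    ∃ h : StrongDual ℂ A, (∀ c : A, 0 ≤ c → 0 ≤ h c) ∧
      (∀ x : A, IsSelfAdjoint x → h x = ((g x).re : ℂ)) ∧ ‖h‖ ≤ ‖g‖ := by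
  let l : A →ₗ[ℂ] ℂ :=
    { toFun := fun a => (g a + conj (g (star a))) / 2
      map_add' := fun a b => by simp only [star_add, map_add]; ring
      map_smul' := fun c a => by simp [star_smul]; ring }
  have hl : ∀ a, ‖l a‖ ≤ ‖g‖ * ‖a‖ := fun a => by
    have h1 : ‖g a + conj (g (star a))‖ ≤ ‖g‖ * ‖a‖ + ‖g‖ * ‖a‖ := by
      refine (norm_add_le _ _).trans (add_le_add (g.le_opNorm a) ?_)
      rw [RCLike.norm_conj]
      simpa using g.le_opNorm (star a)
    change ‖(g a + conj (g (star a))) / 2‖ ≤ _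
    rw [norm_div, Complex.norm_two]
    linarith
  have hsa : ∀ x : A, IsSelfAdjoint x → l x = ((g x).re : ℂ) := fun x hx => by
    change (g x + conj (g (star x))) / 2 = _
    rw [hx.star_eq, Complex.add_conj]
    push_cast
    ring
  refine ⟨l.mkContinuous ‖g‖ hl, fun c hc => ?_, hsa, l.mkContinuous_norm_le (norm_nonneg _) hl⟩
  rw [LinearMap.mkContinuous_apply, hsa c (.of_nonneg hc)]
  exact_mod_cast hg c hc

theorem smul_inv_norm_mem_stateSpace {h : StrongDual ℂ A} (hpos : ∀ c : A, 0 ≤ c → 0 ≤ h c)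
    (hne : h ≠ 0) : ((‖h‖⁻¹ : ℝ) : ℂ) • h ∈ stateSpace A := by
  refine ⟨fun a ha => ?_, ?_⟩
  · have : (0 : ℂ) ≤ ((‖h‖⁻¹ : ℝ) : ℂ) := by
      exact_mod_cast inv_nonneg.2 (norm_nonneg h)
    exact mul_nonneg this (hpos a ha)
  · rw [norm_smul, Complex.norm_real, norm_inv, norm_norm, inv_mul_cancel₀ (norm_ne_zero_iff.2 hne)]

theorem stateSpace_apply_star {φ : StrongDual ℂ A} (hφ : φ ∈ stateSpace A) (x : A) :
    φ (star x) = conj (φ x) := by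
  let f : A →ₚ[ℂ] ℂ := .mk₀ φ.toLinearMap hφ.1
  exact map_star f x

/-- States detect positivity of self-adjoint elements. -/
theorem nonneg_of_isSelfAdjoint_of_stateSpace {x : A} (hx : IsSelfAdjoint x)
    (h : ∀ φ ∈ stateSpace A, 0 ≤ φ x) : 0 ≤ x := by
  by_contra hn
  have hconv : Convex ℝ {a : A | 0 ≤ a} := by
    simpa [Set.Ici] using convex_Ici (𝕜 := ℝ) (0 : A)
  obtain ⟨g, u, hgx, hgu⟩ := RCLike.geometric_hahn_banach_point_closed (𝕜 := ℂ) hconv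
    CStarAlgebra.isClosed_nonneg (show x ∉ {a : A | 0 ≤ a} from hn)
  have hu : u < 0 := by simpa using hgu 0 (le_refl (0 : A))
  have hg : ∀ c : A, 0 ≤ c → 0 ≤ (g c).re := fun c hc => by
    by_contra! hlt
    -- The scalar is chosen so that `g` takes real part exactly `u` at the scaled point, against the
    -- strict separation.
    have h1 := hgu (((u / (g c).re : ℝ)) • c)
      (smul_nonneg (div_nonneg_of_nonpos hu.le hlt.le) hc)
    rw [← Complex.coe_smul, map_smul, smul_eq_mul] at h1
    simp [hlt.ne] at h1
  obtain ⟨k, hk, hksa, -⟩ := exists_positive_functional_of_re_nonneg g hg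
  have hkx : k x = ((g x).re : ℂ) := hksa x hx
  have hgneg : (g x).re < 0 := hgx.trans hu
  have hk0 : k ≠ 0 := by
    rintro rfl
    have : (g x).re = 0 := by simpa using hkx.symm
    exact hgneg.ne this
  have := h _ (smul_inv_norm_mem_stateSpace hk hk0)
  rw [smul_apply, hkx, smul_eq_mul, ← Complex.ofReal_mul] at this
  have h2 : 0 ≤ ‖k‖⁻¹ * (g x).re := by exact_mod_cast this
  exact (mul_neg_of_pos_of_neg (inv_pos.2 (norm_pos_iff.2 hk0)) hgneg).not_ge h2

/-- States detect positivity. -/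
theorem nonneg_of_stateSpace {x : A} (h : ∀ φ ∈ stateSpace A, 0 ≤ φ x) : 0 ≤ x := by
  refine nonneg_of_isSelfAdjoint_of_stateSpace ?_ h
  -- States are real on `x`, so they all vanish on the self-adjoint element `i(x - x*)`, which is
  -- therefore both `≥ 0` and `≤ 0`.
  have key : ∀ φ ∈ stateSpace A, φ (Complex.I • (x - star x)) = 0 := fun φ hφ => by
    rw [map_smul, map_sub, stateSpace_apply_star hφ,
      Complex.conj_eq_iff_im.2 (Complex.nonneg_iff.1 (h φ hφ)).2.symm, sub_self, smul_zero]
  have hsa : IsSelfAdjoint (Complex.I • (x - star x)) := by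
    rw [IsSelfAdjoint, star_smul, star_sub, star_star, Complex.star_def, Complex.conj_I, neg_smul,
      ← smul_neg, neg_sub]
  have h1 := nonneg_of_isSelfAdjoint_of_stateSpace hsa fun φ hφ => (key φ hφ).ge
  have h2 := nonneg_of_isSelfAdjoint_of_stateSpace hsa.neg fun φ hφ => by
    rw [map_neg, key φ hφ, neg_zero]
  have h3 : Complex.I • (x - star x) = 0 := le_antisymm (neg_nonneg.1 h2) h1
  exact (sub_eq_zero.1 ((smul_eq_zero_iff_right Complex.I_ne_zero).1 h3)).symm

/-- The norm of a nonzero positive element is attained at a state. -/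
theorem exists_stateSpace_apply_eq_norm {z : A} (hz : 0 ≤ z) (hz0 : z ≠ 0) :
    ∃ φ ∈ stateSpace A, φ z = (‖z‖ : ℂ) := by
  have hr : 0 < ‖z‖ := norm_pos_iff.2 hz0
  -- Separating `z` from ball minus cone gives both properties at once: the ball forces `‖g‖ ‖z‖ ≤
  -- Re g z`, the cone forces `Re g ≥ 0` on positives.
  have hconv : Convex ℝ (Metric.ball (0 : A) ‖z‖ - {a : A | 0 ≤ a}) :=
    (convex_ball _ _).sub (by simpa [Set.Ici] using convex_Ici (𝕜 := ℝ) (0 : A))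
  have hopen : IsOpen (Metric.ball (0 : A) ‖z‖ - {a : A | 0 ≤ a}) := Metric.isOpen_ball.sub_right
  have hnot : z ∉ Metric.ball (0 : A) ‖z‖ - {a : A | 0 ≤ a} := by
    rintro ⟨b, hb, c, hc, hbc⟩
    have hzb : z ≤ b := by
      rw [← hbc]
      exact sub_le_self b hc
    have := CStarAlgebra.norm_le_norm_of_nonneg_of_le hz hzb
    rw [mem_ball_zero_iff] at hb
    exact hb.not_ge this
  obtain ⟨g, hg⟩ := RCLike.geometric_hahn_banach_open_point (𝕜 := ℂ) hconv hopen hnot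
  have hball : ∀ b : A, ‖b‖ < ‖z‖ → (g b).re < (g z).re := fun b hb =>
    hg b ⟨b, by simpa using hb, 0, le_refl (0 : A), sub_zero b⟩
  have hgz : 0 < (g z).re := by simpa using hball 0 (by simpa using hr)
  have hcone : ∀ c : A, 0 ≤ c → 0 ≤ (g c).re := fun c hc => by
    by_contra! hlt
    have h1 := hg (0 - ((-((g z).re / (g c).re) : ℝ)) • c) ⟨0, by simpa using hr, _,
      smul_nonneg (neg_nonneg.2 (div_nonpos_of_nonneg_of_nonpos hgz.le hlt.le)) hc, rfl⟩
    rw [← Complex.coe_smul, map_sub, map_smul, smul_eq_mul] at h1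
    simp [hlt.ne] at h1
  have hnorm : ‖g‖ * ‖z‖ ≤ (g z).re := by
    rw [← le_div_iff₀ hr]
    refine g.opNorm_le_bound (by positivity) fun x => ?_
    by_contra! hlt
    have hx : 0 < ‖g x‖ := lt_of_le_of_lt (by positivity) hlt
    obtain ⟨c, hc, hcx⟩ := Complex.exists_norm_eq_mul_self (g x)
    have h1 := hball ((((g z).re / ‖g x‖ : ℝ) : ℂ) • c • x) (by
      rw [norm_smul, norm_smul, hc, one_mul, Complex.norm_real, Real.norm_of_nonneg (by positivity),
        div_mul_eq_mul_div, div_lt_iff₀ hx]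
      rwa [div_mul_eq_mul_div, div_lt_iff₀ hr, mul_comm ‖g x‖] at hlt)
    rw [map_smul, map_smul, smul_eq_mul c, ← hcx, smul_eq_mul, ← Complex.ofReal_mul,
      Complex.ofReal_re, div_mul_cancel₀ _ hx.ne'] at h1
    exact h1.false
  obtain ⟨k, hk, hksa, hkg⟩ := exists_positive_functional_of_re_nonneg g hcone
  have hkz := hksa z (.of_nonneg hz)
  have hk0 : k ≠ 0 := by
    rintro rfl
    have : (g z).re = 0 := by simpa using hkz.symm
    exact hgz.ne' this
  have heq : (g z).re = ‖k‖ * ‖z‖ := by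
    refine le_antisymm ?_ ((mul_le_mul_of_nonneg_right hkg hr.le).trans hnorm)
    have := k.le_opNorm z
    rwa [hkz, Complex.norm_real, Real.norm_of_nonneg hgz.le] at this
  refine ⟨_, smul_inv_norm_mem_stateSpace hk hk0, ?_⟩
  rw [smul_apply, hkz, smul_eq_mul, ← Complex.ofReal_mul, heq,
    inv_mul_cancel_left₀ (norm_ne_zero_iff.2 hk0)]

end States

/-! ### Kadison's inequality via Bernstein polynomials, and the Jordan identity -/

section Kadison

variable {U : Type*} [CStarAlgebra U] [PartialOrder U] [StarOrderedRing U]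

open Polynomial Filter Topology

theorem nonneg_of_forall_nat_smul_add_nonneg {K L : U} (h : ∀ n : ℕ, 0 < n → 0 ≤ (n : ℝ) • K + L) :
    0 ≤ K := by
  have h1 : Tendsto (fun n : ℕ => K + ((n : ℝ)⁻¹) • L) atTop (𝓝 (K + (0 : ℝ) • L)) :=
    tendsto_const_nhds.add (tendsto_inv_atTop_nhds_zero_nat.smul_const L)
  rw [zero_smul, add_zero] at h1
  refine CStarAlgebra.isClosed_nonneg.mem_of_tendsto h1 ?_
  filter_upwards [eventually_gt_atTop 0] with n hn
  have hn' : (n : ℝ) ≠ 0 := by positivity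
  have : K + ((n : ℝ)⁻¹) • L = (n : ℝ)⁻¹ • ((n : ℝ) • K + L) := by
    rw [smul_add, smul_smul, inv_mul_cancel₀ hn', one_smul]
  change 0 ≤ K + ((n : ℝ)⁻¹) • L
  rw [this]
  exact smul_nonneg (by positivity) (h n hn)

theorem aeval_bernsteinPolynomial_nonneg {a : U} (h0 : 0 ≤ a) (h1 : a ≤ 1) (n k : ℕ) :
    0 ≤ aeval a (bernsteinPolynomial ℝ n k) := by
  have ha : IsSelfAdjoint a := .of_nonneg h0
  rw [← cfc_polynomial _ a]
  refine cfc_nonneg fun x hx => ?_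
  have hx0 : 0 ≤ x := spectrum_nonneg_of_nonneg h0 hx
  have hx1 : x ≤ 1 := by
    rw [← map_one (algebraMap ℝ U)] at h1
    exact (le_algebraMap_iff_spectrum_le (r := (1 : ℝ)) (a := a)).1 h1 x hx
  have : 0 ≤ 1 - x := by linarith
  simp only [bernsteinPolynomial, eval_mul, eval_natCast, eval_pow, eval_X, eval_sub, eval_one]
  positivity

theorem sum_sq_smul_bernsteinPolynomial (n : ℕ) :
    ∑ k ∈ Finset.range (n + 1), ((k : ℝ) ^ 2) • bernsteinPolynomial ℝ n k =
      ((n : ℝ) ^ 2) • X ^ 2 + (n : ℝ) • (X - X ^ 2) := by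
  have h1 := bernsteinPolynomial.sum_smul ℝ n
  have h2 := bernsteinPolynomial.sum_mul_smul ℝ n
  have h3 : ∑ k ∈ Finset.range (n + 1), ((k : ℝ) ^ 2) • bernsteinPolynomial ℝ n k =
      (∑ k ∈ Finset.range (n + 1), (k * (k - 1)) • bernsteinPolynomial ℝ n k) +
      ∑ k ∈ Finset.range (n + 1), k • bernsteinPolynomial ℝ n k := by
    rw [← Finset.sum_add_distrib]
    refine Finset.sum_congr rfl fun k _ => ?_
    rw [← add_smul, ← Nat.cast_smul_eq_nsmul ℝ]
    congr 1
    cases k <;> simp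
    ring
  rw [h3, h1, h2, ← Nat.cast_smul_eq_nsmul ℝ, ← Nat.cast_smul_eq_nsmul ℝ]
  have : ((n * (n - 1) : ℕ) : ℝ) = (n : ℝ) ^ 2 - n := by
    cases n <;> simp
    ring
  rw [this]
  module

variable {Q : U →ₗ[ℂ] U}

/-- The elements `e k = Q (B_{n,k}(a))` behave like a distribution on `0, …, n`: positive, with sum
`1` and mean `n x`, where `x = Q a`. The sum of `(k - n x) e k (k - n x)` is nonnegative and equals
`n² (Q (a²) - x²) + n (x - Q (a²))`; divide by `n` and let `n → ∞`. -/
theorem sq_map_le_map_sq_of_le_one (hpos : ∀ x, 0 ≤ x → 0 ≤ Q x) (hone : Q 1 = 1) {a : U}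
    (h0 : 0 ≤ a) (h1 : a ≤ 1) : 0 ≤ Q (a ^ 2) - Q a ^ 2 := by
  refine nonneg_of_forall_nat_smul_add_nonneg (L := Q a - Q (a ^ 2)) fun n hn => ?_
  set e : ℕ → U := fun k => Q (aeval a (bernsteinPolynomial ℝ n k)) with he
  set x := Q a with hx
  have hxsa : IsSelfAdjoint x := .of_nonneg (hpos a h0)
  have hs0 : ∑ k ∈ Finset.range (n + 1), e k = 1 := by
    rw [← map_sum, ← map_sum, bernsteinPolynomial.sum, map_one, hone]
  have hs1 : ∑ k ∈ Finset.range (n + 1), (k : ℝ) • e k = (n : ℝ) • x := by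
    have := congrArg (fun p => Q (aeval a p)) (bernsteinPolynomial.sum_smul ℝ n)
    simpa only [map_sum, ← Nat.cast_smul_eq_nsmul ℝ, map_smul, LinearMap.map_smul_of_tower,
      aeval_X] using this
  have hs2 : ∑ k ∈ Finset.range (n + 1), ((k : ℝ) ^ 2) • e k =
      ((n : ℝ) ^ 2) • Q (a ^ 2) + (n : ℝ) • (x - Q (a ^ 2)) := by
    simp only [he, ← LinearMap.map_smul_of_tower Q, ← map_smul, ← map_sum, sum_sq_smul_bernsteinPolynomial]
    simp [hx]
  have hterm : ∀ k : ℕ, ((k : ℝ) • (1 : U) - (n : ℝ) • x) * e k * ((k : ℝ) • (1 : U) - (n : ℝ) • x)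
      = ((k : ℝ) ^ 2) • e k - (n : ℝ) • (x * ((k : ℝ) • e k) + ((k : ℝ) • e k) * x)
        + ((n : ℝ) ^ 2) • (x * e k * x) := fun k => by
    simp only [sub_mul, mul_sub, smul_mul_assoc, mul_smul_comm, one_mul, mul_one, mul_assoc]
    module
  have hsum : 0 ≤ ∑ k ∈ Finset.range (n + 1),
      ((k : ℝ) • (1 : U) - (n : ℝ) • x) * e k * ((k : ℝ) • (1 : U) - (n : ℝ) • x) := by
    refine Finset.sum_nonneg fun k _ => ?_
    exact (((IsSelfAdjoint.all (k : ℝ)).smul (.one U)).sub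
      ((IsSelfAdjoint.all (n : ℝ)).smul hxsa)).conjugate_nonneg
      (hpos _ (aeval_bernsteinPolynomial_nonneg h0 h1 n k))
  simp only [hterm] at hsum
  rw [Finset.sum_add_distrib, Finset.sum_sub_distrib, ← Finset.smul_sum, ← Finset.smul_sum,
    Finset.sum_add_distrib, ← Finset.mul_sum, ← Finset.sum_mul, ← Finset.sum_mul, ← Finset.mul_sum,
    hs0, hs1, hs2, mul_one, mul_smul_comm, smul_mul_assoc] at hsum
  have hn' : (n : ℝ) ≠ 0 := by positivity
  have := smul_nonneg (inv_nonneg.2 n.cast_nonneg : (0 : ℝ) ≤ (n : ℝ)⁻¹) hsum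
  convert this using 1
  rw [pow_two (n : ℝ), mul_smul, mul_smul, ← smul_add, ← smul_sub, ← smul_add, smul_smul,
    inv_mul_cancel₀ hn', one_smul, pow_two x]
  module

/-- Kadison's inequality for self-adjoint elements. -/
theorem sq_map_le_map_sq (hpos : ∀ x, 0 ≤ x → 0 ≤ Q x) (hone : Q 1 = 1) {a : U}
    (ha : IsSelfAdjoint a) : 0 ≤ Q (a ^ 2) - Q a ^ 2 := by
  -- An affine change of variable moves `a` into `[0, 1]`; the `+ 1` keeps `M` positive when `a =
  -- 0`.
  set M : ℝ := 2 * ‖a‖ + 1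
  have hM : 0 < M := by positivity
  set c : U := M⁻¹ • (a + algebraMap ℝ U ‖a‖) with hc
  have hc0 : 0 ≤ c :=
    smul_nonneg (by positivity) (by
      have := ha.neg_algebraMap_norm_le_self
      rwa [neg_le_iff_add_nonneg] at this)
  have hc1 : c ≤ 1 := by
    have h1 : a + algebraMap ℝ U ‖a‖ ≤ M • (1 : U) := by
      have h2 : M • (1 : U) = algebraMap ℝ U ‖a‖ + algebraMap ℝ U ‖a‖ + 1 := by
        simp only [M, Algebra.algebraMap_eq_smul_one]
        module
      rw [h2]
      exact (add_le_add_left ha.le_algebraMap_norm_self _).trans (le_add_of_nonneg_right zero_le_one)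
    have := smul_le_smul_of_nonneg_left h1 (inv_nonneg.2 hM.le)
    rwa [smul_smul, inv_mul_cancel₀ hM.ne', one_smul] at this
  have key := sq_map_le_map_sq_of_le_one hpos hone hc0 hc1
  have hac : a = M • c - ‖a‖ • (1 : U) := by
    rw [hc, smul_smul, mul_inv_cancel₀ hM.ne', one_smul, Algebra.algebraMap_eq_smul_one,
      add_sub_cancel_right]
  have : Q (a ^ 2) - Q a ^ 2 = (M ^ 2) • (Q (c ^ 2) - Q c ^ 2) := by
    rw [hac]
    simp only [pow_two, sub_mul, mul_sub, smul_mul_assoc, mul_smul_comm, one_mul, mul_one, map_sub,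
      LinearMap.map_smul_of_tower, hone]
    module
  rw [this]
  exact smul_nonneg (by positivity) key

/-- In Kadison's inequality for `a + t b` the `t²` terms cancel. An affine function of `t` that is
nonnegative on all of `ℝ` has slope zero. -/
theorem jordan_of_isSelfAdjoint (hpos : ∀ x, 0 ≤ x → 0 ≤ Q x) (hone : Q 1 = 1) {a b : U}
    (ha : IsSelfAdjoint a) (hb : IsSelfAdjoint b) (hQb : Q b = b) (hQb2 : Q (b ^ 2) = b ^ 2) :
    Q (a * b + b * a) = Q a * b + b * Q a := by
  have key : ∀ t : ℝ, 0 ≤ t • (Q (a * b + b * a) - (Q a * b + b * Q a)) +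
      (Q (a ^ 2) - Q a ^ 2) := fun t => by
    convert sq_map_le_map_sq hpos hone (ha.add ((IsSelfAdjoint.all t).smul hb)) using 1
    simp only [pow_two, add_mul, mul_add, smul_mul_assoc, mul_smul_comm, map_add,
      LinearMap.map_smul_of_tower, hQb] at hQb2 ⊢
    rw [hQb2]
    module
  refine (sub_eq_zero.1 (le_antisymm ?_ ?_))
  · refine neg_nonneg.1 (nonneg_of_forall_nat_smul_add_nonneg (L := Q (a ^ 2) - Q a ^ 2) fun n _ => ?_)
    have := key (-(n : ℝ))
    rwa [neg_smul, ← smul_neg] at this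
  · exact nonneg_of_forall_nat_smul_add_nonneg fun n _ => key n

end Kadison

/-! ### From the Jordan identity to one-sided module maps -/

section UnitalBimodule

variable {U : Type*} [CStarAlgebra U] [PartialOrder U] [StarOrderedRing U] {Q : U →ₗ[ℂ] U}

theorem map_star_of_pos (hpos : ∀ x, 0 ≤ x → 0 ≤ Q x) (a : U) : Q (star a) = star (Q a) :=
  map_star (PositiveLinearMap.mk₀ Q hpos) a

theorem jordan_bimodule (hpos : ∀ x, 0 ≤ x → 0 ≤ Q x) (hone : Q 1 = 1)
    (hmul : ∀ b c, Q b = b → Q c = c → Q (b * c) = b * c) (a : U) {b : U} (hb : Q b = b) :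
    Q (a * b + b * a) = Q a * b + b * Q a := by
  have hstar : Q (star b) = star b := by rw [map_star_of_pos hpos, hb]
  have h1 : ∀ a c : U, IsSelfAdjoint a → IsSelfAdjoint c → Q c = c →
      Q (a * c + c * a) = Q a * c + c * Q a := fun a c ha hc hQ =>
    jordan_of_isSelfAdjoint hpos hone ha hc hQ (by rw [pow_two]; exact hmul c c hQ hQ)
  have hre : Q (realPart b : U) = realPart b := by
    rw [realPart_apply_coe, LinearMap.map_smul_of_tower, map_add, hb, hstar]
  have him : Q (imaginaryPart b : U) = imaginaryPart b := by
    rw [imaginaryPart_apply_coe, map_smul, LinearMap.map_smul_of_tower, map_sub, hb, hstar]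
  have h2 : ∀ a : U, IsSelfAdjoint a → Q (a * b + b * a) = Q a * b + b * Q a := fun a ha => by
    have e1 := h1 a _ ha (realPart b).2 hre
    have e2 := h1 a _ ha (imaginaryPart b).2 him
    rw [← realPart_add_I_smul_imaginaryPart b]
    simp only [mul_add, add_mul, mul_smul_comm, smul_mul_assoc, map_add, map_smul] at e1 e2 ⊢
    linear_combination (norm := module) e1 + Complex.I • e2
  have e1 := h2 _ (realPart a).2
  have e2 := h2 _ (imaginaryPart a).2
  rw [← realPart_add_I_smul_imaginaryPart a]
  simp only [mul_add, add_mul, mul_smul_comm, smul_mul_assoc, map_add, map_smul] at e1 e2 ⊢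
  linear_combination (norm := module) e1 + Complex.I • e2

/-- The map `b ↦ Q (b * a)` obeys a Jordan-type Leibniz rule on the range of `Q` when `Q a = 0`. -/
theorem jordan_leibniz (hpos : ∀ x, 0 ≤ x → 0 ≤ Q x) (hone : Q 1 = 1)
    (hmul : ∀ b c, Q b = b → Q c = c → Q (b * c) = b * c) {a b c : U} (ha : Q a = 0)
    (hb : Q b = b) (hc : Q c = c) :
    (2 : ℂ) • Q (b * c * a) = Q (c * a) * b + b * Q (c * a) + (Q (b * a) * c + c * Q (b * a)) := by
  have J := fun (x y : U) (hy : Q y = y) => jordan_bimodule hpos hone hmul x hy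
  have e1 := J a b hb
  have e2 := J (c * a) b hb
  have e3 := J (a * b) c hc
  have e4 := J a (b * c) (hmul b c hb hc)
  rw [ha, zero_mul, mul_zero, add_zero, map_add] at e1 e4
  rw [map_add] at e2 e3
  rw [eq_neg_of_add_eq_zero_left e1] at e3
  simp only [← mul_assoc, neg_mul, mul_neg] at e2 e3 e4
  rw [two_smul]
  linear_combination (norm := module) e2 - e3 + e4

/-- The Leibniz rule is symmetric in its two arguments, so `D (bc) = D (cb)`. Expanding `D (bcb)` in
two ways shows that `d = D b` anticommutes with `[b, c]`. The choices `c = d` and `c = bd` give `[b,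
d]² = 0`, and `[b, d]` is self-adjoint because `d* = -d`. -/
theorem commute_map_mul (hpos : ∀ x, 0 ≤ x → 0 ≤ Q x) (hone : Q 1 = 1) (hidem : ∀ x, Q (Q x) = Q x)
    (hmul : ∀ b c, Q b = b → Q c = c → Q (b * c) = b * c) {a b : U} (hasa : IsSelfAdjoint a)
    (ha : Q a = 0) (hbsa : IsSelfAdjoint b) (hb : Q b = b) : Commute b (Q (b * a)) := by
  have L := fun {x y : U} (hx : Q x = x) (hy : Q y = y) =>
    jordan_leibniz hpos hone hmul (a := a) ha hx hy
  set d := Q (b * a) with hd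
  have hdd : Q d = d := hidem _
  have key : ∀ c, Q c = c → (b * c - c * b) * d + d * (b * c - c * b) = 0 := fun c hc => by
    have hbc := hmul b c hb hc
    have hcb := hmul c b hc hb
    have hsymm : Q (b * c * a) = Q (c * b * a) := by
      have : (2 : ℂ) • Q (b * c * a) = (2 : ℂ) • Q (c * b * a) := by
        rw [L hb hc, L hc hb]; abel
      exact smul_right_injective U two_ne_zero this
    have e1 := L hb hcb
    have e2 := L hbc hb
    rw [← mul_assoc] at e1
    rw [e1] at e2
    rw [← hsymm, ← hd] at e2
    have e4 : c * b * d + d * (c * b) = b * c * d + d * (b * c) := by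
      linear_combination (norm := module) e2
    rw [sub_mul, mul_sub]
    linear_combination (norm := module) -e4
  have k1 := key d hdd
  have k2 := key (b * d) (hmul b d hb hdd)
  have hdstar : star d = -d := by
    have e := jordan_bimodule hpos hone hmul a hb
    rw [ha, zero_mul, mul_zero, add_zero, map_add] at e
    rw [hd, ← map_star_of_pos hpos, star_mul, hasa.star_eq, hbsa.star_eq]
    exact eq_neg_of_add_eq_zero_left e
  have hw : star (b * d - d * b) = b * d - d * b := by
    rw [star_sub, star_mul, star_mul, hdstar, hbsa.star_eq]
    noncomm_ring
  have hw2 : (b * d - d * b) * (b * d - d * b) = 0 := by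
    have : (b * d - d * b) * (b * d - d * b) =
      b * ((b * d - d * b) * d + d * (b * d - d * b)) -
        ((b * (b * d) - b * d * b) * d + d * (b * (b * d) - b * d * b)) := by noncomm_ring
    rw [this, k1, k2, mul_zero, sub_zero]
  rw [← hw] at hw2
  nth_rewrite 2 [hw] at hw2
  exact sub_eq_zero.1 (CStarRing.star_mul_self_eq_zero_iff _ |>.1 hw2)

theorem map_pow_succ_mul (hpos : ∀ x, 0 ≤ x → 0 ≤ Q x) (hone : Q 1 = 1)
    (hmul : ∀ b c, Q b = b → Q c = c → Q (b * c) = b * c) {a x : U} (ha : Q a = 0) (hx : Q x = x)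
    (hcomm : Commute x (Q (x * a))) (n : ℕ) :
    Q (x ^ (n + 1) * a) = ((n + 1 : ℕ) : ℂ) • (x ^ n * Q (x * a)) := by
  have hpow : ∀ n : ℕ, Q (x ^ n) = x ^ n := fun n => by
    induction n with
    | zero => simpa using hone
    | succ n ih => rw [pow_succ]; exact hmul _ _ ih hx
  induction n with
  | zero => simp
  | succ n ih =>
    have e := jordan_leibniz hpos hone hmul ha hx (hpow (n + 1))
    rw [ih, ← pow_succ'] at e
    have h1 : x ^ n * Q (x * a) * x = x ^ (n + 1) * Q (x * a) := by
      rw [mul_assoc, ← hcomm.eq, ← mul_assoc, ← pow_succ]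
    have h2 : x * (x ^ n * Q (x * a)) = x ^ (n + 1) * Q (x * a) := by
      rw [← mul_assoc, ← pow_succ']
    rw [smul_mul_assoc, mul_smul_comm, h1, h2, ← (hcomm.pow_left (n + 1)).eq] at e
    refine smul_right_injective U (two_ne_zero (α := ℂ)) (e.trans ?_)
    push_cast
    module

open NormedSpace in
theorem map_exp_mul (hpos : ∀ x, 0 ≤ x → 0 ≤ Q x) (hone : Q 1 = 1)
    (hmul : ∀ b c, Q b = b → Q c = c → Q (b * c) = b * c) {a x : U} (ha : Q a = 0) (hx : Q x = x)
    (hcomm : Commute x (Q (x * a))) : Q (exp x * a) = exp x * Q (x * a) := by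
  let F : U →L[ℂ] U := ⟨Q ∘ₗ LinearMap.mulRight ℂ a,
    (map_continuous (PositiveLinearMap.mk₀ Q hpos)).comp (continuous_mul_const a)⟩
  have h0 : HasSum (fun n : ℕ => ((n.factorial : ℂ)⁻¹) • x ^ n) (exp x) :=
    exp_series_hasSum_exp' x
  have h1 : HasSum (fun n : ℕ => F (((n.factorial : ℂ)⁻¹) • x ^ n)) (Q (exp x * a)) := h0.mapL F
  have h2 : HasSum (fun n : ℕ => ((n.factorial : ℂ)⁻¹) • x ^ n * Q (x * a)) (exp x * Q (x * a)) :=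
    h0.mul_right _
  -- The constant term contributes `Q a = 0`; dropping it shifts the series by one, and `(n + 1) /
  -- (n + 1)! = 1 / n!`.
  rw [← hasSum_nat_add_iff' 1] at h1
  have h3 : Q (exp x * a) - ∑ i ∈ Finset.range 1, F (((i.factorial : ℂ)⁻¹) • x ^ i) =
      Q (exp x * a) := by
    have : F 1 = 0 := by
      change Q (1 * a) = 0
      rw [one_mul, ha]
    simp [this]
  rw [h3] at h1
  refine h1.unique (h2.congr_fun fun n => ?_)
  change Q ((((n + 1).factorial : ℂ)⁻¹) • x ^ (n + 1) * a) = _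
  rw [smul_mul_assoc, map_smul, map_pow_succ_mul hpos hone hmul ha hx hcomm, smul_smul,
    smul_mul_assoc, Nat.factorial_succ]
  congr 1
  push_cast
  have : (n : ℂ) + 1 ≠ 0 := by exact_mod_cast n.succ_ne_zero
  field_simp

theorem map_mul_eq_zero_of_isSelfAdjoint (hpos : ∀ x, 0 ≤ x → 0 ≤ Q x) (hone : Q 1 = 1)
    (hidem : ∀ x, Q (Q x) = Q x)
    (hmul : ∀ b c, Q b = b → Q c = c → Q (b * c) = b * c) {a b : U} (hasa : IsSelfAdjoint a)
    (ha : Q a = 0) (hbsa : IsSelfAdjoint b) (hb : Q b = b) : Q (b * a) = 0 := by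
  obtain ⟨C, hC⟩ := (PositiveLinearMap.mk₀ Q hpos).exists_norm_apply_le
  have hcomm := commute_map_mul hpos hone hidem hmul hasa ha hbsa hb
  have key : ∀ n : ℕ, (n : ℝ) * ‖Q (b * a)‖ ≤ C * ‖a‖ := fun n => by
    let x : selfAdjoint U := ⟨(n : ℝ) • b, (IsSelfAdjoint.all (n : ℝ)).smul hbsa⟩
    let u := selfAdjoint.expUnitary x
    set y : U := (Complex.I * (n : ℝ)) • b with hy
    have hu : (u : U) = NormedSpace.exp y := by
      rw [selfAdjoint.expUnitary_coe, hy, mul_smul, Complex.coe_smul (n : ℝ) b]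
    have hya : Q (y * a) = (Complex.I * (n : ℝ)) • Q (b * a) := by rw [hy, smul_mul_assoc, map_smul]
    have e := map_exp_mul hpos hone hmul (x := y) ha (by rw [hy, map_smul, hb])
      (by rw [hya]; exact (hcomm.smul_left _).smul_right _)
    rw [hya, ← hu] at e
    calc (n : ℝ) * ‖Q (b * a)‖ = ‖(u : U) * ((Complex.I * (n : ℝ)) • Q (b * a))‖ := by
          rw [CStarRing.norm_coe_unitary_mul, norm_smul]; simp
      _ = ‖Q (u * a)‖ := by rw [e]
      _ ≤ C * ‖(u : U) * a‖ := hC _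
      _ = C * ‖a‖ := by rw [CStarRing.norm_coe_unitary_mul]
  by_contra hne
  obtain ⟨n, hn⟩ := exists_nat_gt (C * ‖a‖ / ‖Q (b * a)‖)
  rw [div_lt_iff₀ (norm_pos_iff.2 hne)] at hn
  exact (hn.trans_le (key n)).false

/-- A unital positive idempotent map whose range is closed under multiplication is a left module
map over its range. -/
theorem map_mul_of_map_eq_self (hpos : ∀ x, 0 ≤ x → 0 ≤ Q x) (hone : Q 1 = 1)
    (hidem : ∀ x, Q (Q x) = Q x)
    (hmul : ∀ b c, Q b = b → Q c = c → Q (b * c) = b * c) (a : U) {b : U} (hb : Q b = b) :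
    Q (b * a) = b * Q a := by
  have hstar : Q (star b) = star b := by rw [map_star_of_pos hpos, hb]
  have hre : Q (realPart b : U) = realPart b := by
    rw [realPart_apply_coe, LinearMap.map_smul_of_tower, map_add, hb, hstar]
  have him : Q (imaginaryPart b : U) = imaginaryPart b := by
    rw [imaginaryPart_apply_coe, map_smul, LinearMap.map_smul_of_tower, map_sub, hb, hstar]
  have h1 : ∀ a c : U, IsSelfAdjoint a → IsSelfAdjoint c → Q c = c → Q (c * a) = c * Q a :=
    fun a c ha hc hQ => by
      have hsa : IsSelfAdjoint (Q a) := by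
        rw [IsSelfAdjoint, ← map_star_of_pos hpos, ha.star_eq]
      -- `a - Q a` lies in the kernel of `Q` by idempotence.
      have := map_mul_eq_zero_of_isSelfAdjoint hpos hone hidem hmul (ha.sub hsa)
        (by rw [map_sub, hidem, sub_self]) hc hQ
      rwa [mul_sub, map_sub, hmul c _ hQ (hidem a), sub_eq_zero] at this
  have h2 : ∀ a : U, IsSelfAdjoint a → Q (b * a) = b * Q a := fun a ha => by
    have e1 := h1 a _ ha (realPart b).2 hre
    have e2 := h1 a _ ha (imaginaryPart b).2 him
    rw [← realPart_add_I_smul_imaginaryPart b]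
    simp only [add_mul, smul_mul_assoc, map_add, map_smul, e1, e2]
  have e1 := h2 _ (realPart a).2
  have e2 := h2 _ (imaginaryPart a).2
  rw [← realPart_add_I_smul_imaginaryPart a]
  simp only [mul_add, mul_smul_comm, map_add, map_smul, e1, e2]

end UnitalBimodule

/-! ### Positivity of the unital extension -/

section Unitization

variable {A : Type*} [NonUnitalCStarAlgebra A]

/-- The unital extension of a linear map to the unitization. -/
noncomputable def unitizationExtend (P : A →ₗ[ℂ] A) : Unitization ℂ A →ₗ[ℂ] Unitization ℂ A where
  toFun x := Unitization.inl x.fst + Unitization.inr (P x.snd)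
  map_add' x y := by ext <;> simp
  map_smul' c x := by ext <;> simp

theorem unitizationExtend_apply (P : A →ₗ[ℂ] A) (x : Unitization ℂ A) :
    unitizationExtend P x = Unitization.inl x.fst + Unitization.inr (P x.snd) := rfl

theorem unitizationExtend_inr (P : A →ₗ[ℂ] A) (a : A) :
    unitizationExtend P (Unitization.inr a) = Unitization.inr (P a) := by
  simp [unitizationExtend_apply]

theorem unitizationExtend_eq_self_iff (P : A →ₗ[ℂ] A) (x : Unitization ℂ A) :
    unitizationExtend P x = x ↔ P x.snd = x.snd := by
  simp [unitizationExtend_apply, Unitization.ext_iff]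

variable [PartialOrder A] [StarOrderedRing A]

theorem norm_negPart_le_of_nonneg_add {s : A} (hs : IsSelfAdjoint s) {r : ℝ} (hr : 0 ≤ r)
    (h : 0 ≤ algebraMap ℝ (Unitization ℂ A) r + (s : Unitization ℂ A)) : ‖s⁻‖ ≤ r := by
  have hs' : IsSelfAdjoint (s : Unitization ℂ A) := hs.inr ℂ
  have h1 : algebraMap ℝ (Unitization ℂ A) (-r) ≤ (s : Unitization ℂ A) := by
    rwa [map_neg, neg_le_iff_add_nonneg']
  have h2 : ((s⁻ : A) : Unitization ℂ A) ≤ algebraMap ℝ (Unitization ℂ A) r := by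
    rw [CFC.negPart_def, Unitization.real_cfcₙ_eq_cfc_inr s (·⁻) (by simp)]
    refine cfc_le_algebraMap _ _ _ fun t ht => ?_
    have := (algebraMap_le_iff_le_spectrum (a := (s : Unitization ℂ A)) (r := -r)).1 h1 t ht
    exact sup_le (by linarith) hr
  rw [← Unitization.norm_inr (𝕜 := ℂ)]
  exact (CStarAlgebra.norm_le_iff_le_algebraMap _ hr
    (Unitization.inr_nonneg_iff.2 (CFC.negPart_nonneg s))).2 h2

/-- Write `x = r + s` with `s` in `A`. Positivity of `x` gives `‖s⁻‖ ≤ r`, hence `P s⁻ ≤ r`, and the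
image `(r - P s⁻) + P s⁺` is a sum of positives. -/
theorem unitizationExtend_nonneg {P : A →ₗ[ℂ] A} (hpos : ∀ a, 0 ≤ a → 0 ≤ P a)
    (hnorm : ∀ a, 0 ≤ a → ‖P a‖ ≤ ‖a‖) {x : Unitization ℂ A} (hx : 0 ≤ x) :
    0 ≤ unitizationExtend P x := by
  obtain ⟨r, hr, hxr⟩ : ∃ r : ℝ, 0 ≤ r ∧ x.fst = (r : ℂ) := by
    obtain ⟨y, rfl⟩ := CStarAlgebra.nonneg_iff_eq_star_mul_self.1 hx
    refine ⟨‖y.fst‖ ^ 2, by positivity, ?_⟩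
    simp [Complex.conj_mul']
  have hinl : ∀ r : ℝ, (Unitization.inl (r : ℂ) : Unitization ℂ A) = algebraMap ℝ _ r :=
    fun r => rfl
  have hsa : IsSelfAdjoint x.snd := by
    have := congrArg (fun y : Unitization ℂ A => y.snd) (IsSelfAdjoint.of_nonneg hx).star_eq
    simpa [isSelfAdjoint_iff] using this
  have hxs : x = algebraMap ℝ (Unitization ℂ A) r + (x.snd : Unitization ℂ A) := by
    rw [← hinl, ← hxr, Unitization.inl_fst_add_inr_snd_eq]
  rw [hxs] at hx
  have hneg := norm_negPart_le_of_nonneg_add hsa hr hx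
  have h1 : ((P x.snd⁻ : A) : Unitization ℂ A) ≤ algebraMap ℝ (Unitization ℂ A) r := by
    refine (CStarAlgebra.norm_le_iff_le_algebraMap _ hr
      (Unitization.inr_nonneg_iff.2 (hpos _ (CFC.negPart_nonneg _)))).1 ?_
    rw [Unitization.norm_inr]
    exact (hnorm _ (CFC.negPart_nonneg _)).trans hneg
  have h2 : 0 ≤ ((P x.snd⁺ : A) : Unitization ℂ A) :=
    Unitization.inr_nonneg_iff.2 (hpos _ (CFC.posPart_nonneg _))
  have h3 : unitizationExtend P x = (algebraMap ℝ (Unitization ℂ A) r - (P x.snd⁻ : A)) +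
      (P x.snd⁺ : A) := by
    rw [unitizationExtend_apply, hxr, hinl]
    nth_rewrite 1 [← CFC.posPart_sub_negPart x.snd hsa]
    rw [map_sub, Unitization.inr_sub]
    abel
  rw [h3]
  exact add_nonneg (sub_nonneg.2 h1) h2

end Unitization

/-! ### Bimodularity and contractivity of `P` -/

/-- The condition `hstate` says that the adjoint `φ ↦ φ ∘ P` maps states to states; `P` itself is
an arbitrary linear map, not assumed to be bounded. The partial order on `A` is the usual one of a
C*-algebra, pinned down by `StarOrderedRing`. -/
theorem mainTheorem1 {A : Type*} [NonUnitalCStarAlgebra A] [PartialOrder A] [StarOrderedRing A]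
    (P : A →ₗ[ℂ] A) (B : NonUnitalStarSubalgebra ℂ A)
    (hidem : ∀ a : A, P (P a) = P a)
    (hclosed : IsClosed (B : Set A))
    (hrange : Set.range P = (B : Set A))
    (hstate : ∀ φ ∈ stateSpace A, ∃ ψ ∈ stateSpace A, ∀ a : A, ψ a = φ (P a)) :
    IsConditionalExpectation P B := by
  have hpos : ∀ a, 0 ≤ a → 0 ≤ P a := fun a ha => nonneg_of_stateSpace fun φ hφ => by
    obtain ⟨ψ, hψ, h⟩ := hstate φ hφ
    rw [← h]
    exact hψ.1 a ha
  have hnorm : ∀ a, 0 ≤ a → ‖P a‖ ≤ ‖a‖ := fun a ha => by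
    by_cases h0 : P a = 0
    · simp [h0]
    obtain ⟨φ, hφ, hφa⟩ := exists_stateSpace_apply_eq_norm (hpos a ha) h0
    obtain ⟨ψ, hψ, h⟩ := hstate φ hφ
    have := ψ.le_opNorm a
    rwa [hψ.2, one_mul, h, hφa, Complex.norm_real, norm_norm] at this
  have hfix : ∀ b, P b = b ↔ b ∈ B := fun b => by
    rw [← SetLike.mem_coe, ← hrange]
    exact ⟨fun h => ⟨b, h⟩, fun ⟨a, h⟩ => by rw [← h, hidem]⟩
  have hstar : ∀ a, P (star a) = star (P a) := map_star (PositiveLinearMap.mk₀ P hpos)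
  have hleft : ∀ a, ∀ b ∈ B, P (b * a) = b * P a := fun a b hb => by
    have := map_mul_of_map_eq_self (Q := unitizationExtend P)
      (fun _ => unitizationExtend_nonneg hpos hnorm)
      (by rw [unitizationExtend_eq_self_iff]; simp)
      (fun x => by rw [unitizationExtend_eq_self_iff, unitizationExtend_apply]; simp [hidem])
      (fun x y hx hy => by
        rw [unitizationExtend_eq_self_iff, hfix] at hx hy ⊢
        rw [Unitization.snd_mul]
        exact add_mem (add_mem (SMulMemClass.smul_mem _ hy) (SMulMemClass.smul_mem _ hx))
          (mul_mem hx hy))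
      (Unitization.inr a) (b := Unitization.inr b)
      (by rw [unitizationExtend_inr, (hfix b).2 hb])
    rw [← Unitization.inr_mul, unitizationExtend_inr, unitizationExtend_inr,
      ← Unitization.inr_mul] at this
    exact Unitization.inr_injective this
  have hright : ∀ a, ∀ b ∈ B, P (a * b) = P a * b := fun a b hb => by
    have := hleft (star a) (star b) (star_mem hb)
    rwa [← star_mul, hstar, hstar, ← star_mul, star_inj] at this
  have hPmem : ∀ a, P a ∈ B := fun a => (hfix _).1 (hidem a)
  refine ⟨hclosed, hidem, hrange, hpos, fun a => ?_, fun a b hb b' hb' => ?_⟩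
  -- Schwarz inequality: by bimodularity, `P` sends `(a - P a)* (a - P a)` to the difference of the
  -- two sides. The C*-identity then reduces contractivity to the positive element `a* a`.
  · have h1 : star (P a) * P a ≤ P (star a * a) := by
      have h2 := hpos _ (star_mul_self_nonneg (a - P a))
      have h3 : P (star (a - P a) * (a - P a)) = P (star a * a) - star (P a) * P a := by
        rw [star_sub, sub_mul, mul_sub, mul_sub, map_sub, map_sub, map_sub, hright _ _ (hPmem a),
          hleft _ _ (star_mem (hPmem a)), hleft _ _ (star_mem (hPmem a)), hidem, hstar, sub_self,
          sub_zero]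
      rwa [h3, sub_nonneg] at h2
    have h4 : ‖star (P a) * P a‖ ≤ ‖star a * a‖ :=
      (CStarAlgebra.norm_le_norm_of_nonneg_of_le (star_mul_self_nonneg _) h1).trans
        (hnorm _ (star_mul_self_nonneg a))
    rw [CStarRing.norm_star_mul_self, CStarRing.norm_star_mul_self] at h4
    exact nonneg_le_nonneg_of_sq_le_sq (norm_nonneg a) h4
  · rw [hright _ _ hb', hleft _ _ hb]
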